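/- Let $\mathcal I$ be a countable commutative additively cancellative semiring with a non-trivial parity function, i.e. a non-zero homomorphism of additive monoids $p:\mathcal I\to\mathbb Z_2$. Let $V=\bigoplus_{i\in\mathcal I}V_i$ be a finite-dimensional real $\mathcal I$-graded vector space with $V_0=0$. Let $\mathrm S(V)=\bigoplus_k \mathrm S^k(V)$ be the quotient of the tensor algebra of $V$ by the relations $v\otimes w=(-1)^{p(ij)}\,w\otimes v$ for $v\in V_i$, $w\in V_j$, and let $\overline{\mathrm S(V)}=\prod_k\mathrm S^k(V)$. An *$\mathcal I$-graded ringed space* is a topological space with a sheaf $\mathcal O$ of $\mathcal I$-graded real algebras, the restriction maps being homomorphisms of real algebras which preserve degrees. Here an $\mathcal I$-grading of an algebra $A$ is a family of subspaces $A_i$ with $1\in A_0$ and $A_iA_j\subseteq A_{i+j}$, together with linear component maps $A\to A_i$ that restrict to $\delta_{ij}$ on $A_j$ and are jointly injective (so $\bigoplus_i A_i\subseteq A\subseteq\prod_i A_i$). A morphism $\varphi=(\tilde\varphi,\varphi^*)$ of $\mathcal I$-graded ringed spaces is a morphism of ringed spaces whose ring homomorphisms $\varphi^*_U$ preserve degrees.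 A smooth manifold $M$ is regarded as the $\mathcal I$-graded ringed space $(M,C^\infty)$ concentrated in degree $0$. For $U\subseteq\mathbb R^n$ open, the *$\mathcal I$-graded domain* $\mathcal U$ is $U$ with the sheaf of smooth $\overline{\mathrm S(V)}$-valued functions (all components in the finite-dimensional spaces $\mathrm S^k(V)$ are smooth), a function being of degree $i$ if all its values are. An *$\mathcal I$-graded manifold* $\mathcal M=(M,\mathcal O)$ of dimension $n\,|\,(\dim V_i)_{i\in\mathcal I}$ over a smooth $n$-manifold $M$ is an $\mathcal I$-graded ringed space on $M$ such that every point of $M$ has an open neighbourhood $U_x$ with $(U_x,\mathcal O|_{U_x})$ isomorphic, as an $\mathcal I$-graded ringed space, to an $\mathcal I$-graded domain, through an isomorphism whose underlying map is a diffeomorphism. Then: 1. For every open $U\subseteq\mathbb R^n$ there is a unique monomorphism $\varphi:U\to\mathcal U$ with $\tilde\varphi=\mathrm{id}$. 2. For every $\mathcal I$-graded manifold $\mathcal M=(M,\mathcal O)$ there is a unique monomorphism $\varphi:M\to\mathcal M$ with $\tilde\varphi=\mathrm{id}$. In both cases $\varphi$ is a monomorphism in the category of $\mathcal I$-graded ringed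 spaces, its maps $\varphi^*_U$ are homomorphisms of real algebras, and its maps of stalks are surjective local homomorphisms; moreover $\varphi$ is the only morphism at all (monomorphic or not) with underlying map the identity. In particular, the underlying manifold of $\mathcal M$, i.e. $M$ together with a morphism $\varphi:M\to\mathcal M$ with $\tilde\varphi=\mathrm{id}$, exists and is unique. 3. For every smooth manifold $M$, every endomorphism of the sheaf of rings $C^\infty$ on $M$ is the identity. -/

import Mathlib

open CategoryTheory TopologicalSpace Opposite AlgebraicGeometry
open scoped Manifold ContDiff

noncomputable section

/-! ### Graded algebras -/

/-- `𝒜` makes the real algebra `A` into an `ℐ`-graded algebra, where infinite sums of homogeneous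
components are allowed: `1` has degree `0`, degrees add under multiplication, and there are linear
component maps `c i : A → 𝒜 i` which restrict to the Kronecker delta on homogeneous elements
and which jointly determine an element. In other words, `⨁ 𝒜 i ⊆ A ⊆ ∏ 𝒜 i`. -/
structure IsFormalGrading {ℐ : Type*} [AddCommMonoid ℐ] {A : Type*} [Ring A] [Algebra ℝ A]
    (𝒜 : ℐ → Submodule ℝ A) : Prop where
  one_mem : (1 : A) ∈ 𝒜 0
  mul_mem : ∀ {i j : ℐ} {a b : A}, a ∈ 𝒜 i → b ∈ 𝒜 j → a * b ∈ 𝒜 (i + j)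
  exists_component : ∃ c : ℐ → A →ₗ[ℝ] A,
    (∀ i a, c i a ∈ 𝒜 i) ∧ (∀ i, ∀ a ∈ 𝒜 i, c i a = a) ∧
    (∀ i j, i ≠ j → ∀ a ∈ 𝒜 i, c j a = 0) ∧ ∀ a, (∀ i, c i a = 0) → a = 0

/-! ### Graded ringed spaces -/

/-- A sheaf of `ℐ`-graded real algebras on `X`. -/
structure GradedSheaf (ℐ : Type*) [AddCommMonoid ℐ] (X : TopCat.{0}) where
  /-- the underlying sheaf of rings -/
  sheaf : X.Sheaf RingCat.{0}
  /-- every ring of sections is a real algebra -/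
  algebra : ∀ U : Opens X, Algebra ℝ (sheaf.presheaf.obj (op U))
  /-- the homogeneous sections of a given degree -/
  deg : ∀ U : Opens X, ℐ → Submodule ℝ (sheaf.presheaf.obj (op U))
  isFormalGrading : ∀ U : Opens X, IsFormalGrading (deg U)
  map_algebraMap : ∀ {U V : Opens X} (h : V ⟶ U) (r : ℝ),
    (sheaf.presheaf.map h.op).hom (algebraMap ℝ (sheaf.presheaf.obj (op U)) r) =
      algebraMap ℝ (sheaf.presheaf.obj (op V)) r
  map_deg : ∀ {U V : Opens X} (h : V ⟶ U) (i : ℐ), ∀ s ∈ deg U i,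
    (sheaf.presheaf.map h.op).hom s ∈ deg V i

attribute [instance] GradedSheaf.algebra

/-- The restriction of a sheaf of graded algebras to an open subset. -/
def GradedSheaf.restrict {ℐ : Type*} [AddCommMonoid ℐ] {X : TopCat.{0}} (𝒪 : GradedSheaf ℐ X)
    (U : Opens X) : GradedSheaf ℐ (TopCat.of U) where
  sheaf := ⟨U.isOpenEmbedding.isOpenMap.functor.op ⋙ 𝒪.sheaf.presheaf,
    TopCat.Presheaf.isSheaf_of_isOpenEmbedding (f := TopCat.ofHom ⟨_, continuous_subtype_val⟩)
      U.isOpenEmbedding 𝒪.sheaf.property⟩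
  algebra W := 𝒪.algebra (U.isOpenEmbedding.isOpenMap.functor.obj W)
  deg W := 𝒪.deg (U.isOpenEmbedding.isOpenMap.functor.obj W)
  isFormalGrading W := 𝒪.isFormalGrading (U.isOpenEmbedding.isOpenMap.functor.obj W)
  map_algebraMap h r := 𝒪.map_algebraMap (U.isOpenEmbedding.isOpenMap.functor.map h) r
  map_deg h i s hs := 𝒪.map_deg (U.isOpenEmbedding.isOpenMap.functor.map h) i s hs

/-- An `ℐ`-graded ringed space: a topological space with a sheaf of `ℐ`-graded real algebras. -/
structure GradedRingedSpace (ℐ : Type*) [AddCommMonoid ℐ] where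
  carrier : TopCat.{0}
  𝒪 : GradedSheaf ℐ carrier

namespace GradedRingedSpace

variable {ℐ : Type*} [AddCommMonoid ℐ]

/-- The underlying ringed space (the rings of sections need not be commutative). -/
def toSheafedSpace (X : GradedRingedSpace ℐ) : SheafedSpace RingCat.{0} where
  carrier := X.carrier
  presheaf := X.𝒪.sheaf.presheaf
  IsSheaf := X.𝒪.sheaf.property

/-- A morphism of graded ringed spaces `X ⟶ Y`: a morphism of ringed spaces, that is, a continuous
map `base` and a morphism `c` of sheaves of rings from `𝒪_Y` to the pushforward of `𝒪_X`, which
preserves the grading. -/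
structure Hom (X Y : GradedRingedSpace ℐ) where
  toHom : X.toSheafedSpace.toPresheafedSpace ⟶ Y.toSheafedSpace.toPresheafedSpace
  map_deg : ∀ (U : Opens Y.carrier) (i : ℐ), ∀ s ∈ Y.𝒪.deg U i,
    (toHom.c.app (op U)).hom s ∈ X.𝒪.deg ((Opens.map toHom.base).obj U) i

instance : Category (GradedRingedSpace ℐ) where
  Hom := Hom
  id X := ⟨𝟙 _, fun _ _ _ hs => hs⟩
  comp f g := ⟨f.toHom ≫ g.toHom, fun U i s hs => f.map_deg _ i _ (g.map_deg U i s hs)⟩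

variable {X Y : GradedRingedSpace ℐ}

/-- The underlying continuous map. -/
def base (φ : X ⟶ Y) : X.carrier ⟶ Y.carrier := φ.toHom.base

/-- The homomorphism `φ^*_U : 𝒪_Y(U) → 𝒪_X(φ⁻¹ U)`. -/
def app (φ : X ⟶ Y) (U : Opens Y.carrier) :
    Y.𝒪.sheaf.presheaf.obj (op U) →+*
      X.𝒪.sheaf.presheaf.obj (op ((Opens.map (base φ)).obj U)) :=
  (φ.toHom.c.app (op U)).hom

/-- The induced homomorphism of stalks `𝒪_{Y, φ(x)} → 𝒪_{X, x}`. -/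
def stalkMap (φ : X ⟶ Y) (x : X.carrier) :
    Y.𝒪.sheaf.presheaf.stalk (base φ x) →+* X.𝒪.sheaf.presheaf.stalk x :=
  (PresheafedSpace.Hom.stalkMap φ.toHom x).hom

/-- The homomorphisms of stalks are local, as for morphisms of locally ringed spaces. -/
def IsLocal (φ : X ⟶ Y) : Prop :=
  ∀ x : X.carrier, IsLocalHom (stalkMap φ x)

/-- `φ^* : 𝒪_Y → φ_* 𝒪_X` is `ℝ`-linear. -/
def IsRealLinear (φ : X ⟶ Y) : Prop :=
  ∀ (U : Opens Y.carrier) (r : ℝ), app φ U (algebraMap ℝ _ r) = algebraMap ℝ _ r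

/-- The homomorphisms of stalks are surjective. -/
def IsStalkSurjective (φ : X ⟶ Y) : Prop :=
  ∀ x : X.carrier, Function.Surjective (stalkMap φ x)

end GradedRingedSpace

/-! ### The symmetric algebra of a graded vector space and its completion -/

section Symmetric

variable {ℐ : Type*} [NonUnitalCommSemiring ℐ] (p : ℐ →+ ZMod 2)
  {V : Type} [AddCommGroup V] [Module ℝ V] (𝒱 : ℐ → Submodule ℝ V)

/-- The relations `v ⊗ w = (-1)^{p(d(v) d(w))} w ⊗ v` for homogeneous `v` and `w`. -/
inductive SymRel : TensorAlgebra ℝ V → TensorAlgebra ℝ V → Prop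
  | comm (i j : ℐ) (v w : V) (hv : v ∈ 𝒱 i) (hw : w ∈ 𝒱 j) :
      SymRel (TensorAlgebra.ι ℝ v * TensorAlgebra.ι ℝ w)
        (((-1 : ℝ) ^ (p (i * j)).val) • (TensorAlgebra.ι ℝ w * TensorAlgebra.ι ℝ v))

/-- The symmetric algebra `S(V)` of the graded vector space `V = ⨁ 𝒱 i`. -/
def GradedSym : Type := RingQuot (SymRel p 𝒱)

instance : Ring (GradedSym p 𝒱) := inferInstanceAs (Ring (RingQuot (SymRel p 𝒱)))

instance : Algebra ℝ (GradedSym p 𝒱) := inferInstanceAs (Algebra ℝ (RingQuot (SymRel p 𝒱)))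

/-- The quotient map `T(V) → S(V)`. -/
def GradedSym.mk : TensorAlgebra ℝ V →ₐ[ℝ] GradedSym p 𝒱 := RingQuot.mkAlgHom ℝ (SymRel p 𝒱)

/-- The canonical map `V → S(V)`. -/
def GradedSym.ι : V →ₗ[ℝ] GradedSym p 𝒱 :=
  (GradedSym.mk p 𝒱).toLinearMap ∘ₗ TensorAlgebra.ι ℝ

/-- The subspace `S^n(V)` of `S(V)` spanned by the products of `n` elements of `V`. -/
def symPow (n : ℕ) : Submodule ℝ (GradedSym p 𝒱) :=
  LinearMap.range (GradedSym.ι p 𝒱) ^ n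

/-- The subspace `S^n(V)_i` of `S^n(V)` spanned by the products of `n` homogeneous elements of `V`
whose degrees sum up to `i`. -/
def symDeg (n : ℕ) (i : ℐ) : Submodule ℝ (GradedSym p 𝒱) :=
  Submodule.span ℝ {a | ∃ l : List (Σ j : ℐ, 𝒱 j), l.length = n ∧
    (l.map fun v => v.1).sum = i ∧ (l.map fun v => GradedSym.ι p 𝒱 v.2.1).prod = a}

/-- The algebra of formal power series `∏ₙ S^n(V)`, with the Cauchy product. -/
def FormalSym : Subalgebra ℝ (PowerSeries (GradedSym p 𝒱)) where
  carrier := {f | ∀ n, PowerSeries.coeff n f ∈ symPow p 𝒱 n}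
  mul_mem' := by
    intro f g hf hg n
    rw [PowerSeries.coeff_mul]
    refine Submodule.sum_mem _ fun x hx => ?_
    rw [← Finset.HasAntidiagonal.mem_antidiagonal.mp hx]
    unfold symPow
    rw [pow_add]
    exact Submodule.mul_mem_mul (hf _) (hg _)
  add_mem' := by
    intro f g hf hg n
    rw [map_add]
    exact add_mem (hf n) (hg n)
  algebraMap_mem' := by
    intro r n
    rw [PowerSeries.algebraMap_apply, PowerSeries.coeff_C]
    split_ifs with h
    · subst h
      unfold symPow
      rw [pow_zero]
      exact Submodule.algebraMap_mem r
    · exact zero_mem _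

end Symmetric

section SymLemmas

variable {ℐ : Type*} [NonUnitalCommSemiring ℐ] {p : ℐ →+ ZMod 2}
  {V : Type} [AddCommGroup V] [Module ℝ V] {𝒱 : ℐ → Submodule ℝ V}

theorem symPow_fg [FiniteDimensional ℝ V] (n : ℕ) : (symPow p 𝒱 n).FG := by
  apply Submodule.FG.pow
  rw [LinearMap.range_eq_map]
  exact Module.Finite.fg_top.map _

/-- A basis expansion in `S^n(V)` with coefficients given by functionals on `S(V)`. -/
theorem symPow_expansion [FiniteDimensional ℝ V] (n : ℕ) :
    ∃ (k : ℕ) (e : Fin k → GradedSym p 𝒱) (l : Fin k → Module.Dual ℝ (GradedSym p 𝒱)),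
      ∀ a ∈ symPow p 𝒱 n, a = ∑ t, l t a • e t := by
  have : Module.Finite ℝ (symPow p 𝒱 n) := Module.Finite.iff_fg.mpr (symPow_fg n)
  let b := Module.finBasis ℝ (symPow p 𝒱 n)
  choose l hl using fun t => LinearMap.exists_extend (b.coord t)
  refine ⟨_, fun t => (b t : GradedSym p 𝒱), l, fun a ha => ?_⟩
  have h1 : ∀ t, l t a = b.repr ⟨a, ha⟩ t := fun t =>
    LinearMap.congr_fun (hl t) (⟨a, ha⟩ : symPow p 𝒱 n)
  have h2 := congrArg Subtype.val (b.sum_repr ⟨a, ha⟩)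
  simp only [h1]
  rw [Submodule.coe_sum] at h2
  exact h2.symm

theorem GradedSym.ι_comm {i j : ℐ} {v w : V} (hv : v ∈ 𝒱 i) (hw : w ∈ 𝒱 j) :
    GradedSym.ι p 𝒱 v * GradedSym.ι p 𝒱 w =
      ((-1 : ℝ) ^ (p (i * j)).val) • (GradedSym.ι p 𝒱 w * GradedSym.ι p 𝒱 v) := by
  have h : GradedSym.mk p 𝒱 _ = GradedSym.mk p 𝒱 _ :=
    RingQuot.mkAlgHom_rel ℝ (SymRel.comm (p := p) (𝒱 := 𝒱) i j v w hv hw)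
  simpa [GradedSym.ι] using h

theorem one_mem_symDeg : (1 : GradedSym p 𝒱) ∈ symDeg p 𝒱 0 0 :=
  Submodule.subset_span ⟨[], rfl, rfl, rfl⟩

theorem mul_mem_symDeg {m n : ℕ} {i j : ℐ} {a b : GradedSym p 𝒱}
    (ha : a ∈ symDeg p 𝒱 m i) (hb : b ∈ symDeg p 𝒱 n j) :
    a * b ∈ symDeg p 𝒱 (m + n) (i + j) := by
  have h := Submodule.mul_mem_mul ha hb
  unfold symDeg at h
  rw [Submodule.span_mul_span] at h
  refine Submodule.span_mono ?_ h
  rintro _ ⟨_, ⟨l, rfl, rfl, rfl⟩, _, ⟨l', rfl, rfl, rfl⟩, rfl⟩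
  exact ⟨l ++ l', by simp⟩

theorem symDeg_le {n : ℕ} {i : ℐ} : symDeg p 𝒱 n i ≤ symPow p 𝒱 n := by
  refine Submodule.span_le.mpr ?_
  rintro _ ⟨l, rfl, rfl, rfl⟩
  change _ ∈ symPow p 𝒱 l.length
  unfold symPow
  induction l with
  | nil =>
    rw [List.map_nil, List.prod_nil, List.length_nil, pow_zero]
    exact Submodule.one_le.mp le_rfl
  | cons v l ih =>
    rw [List.map_cons, List.prod_cons, List.length_cons, pow_succ']
    exact Submodule.mul_mem_mul ⟨_, rfl⟩ ih

theorem symPow_le_iSup [DecidableEq ℐ] [DirectSum.Decomposition 𝒱] (n : ℕ) :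
    symPow p 𝒱 n ≤ ⨆ i, symDeg p 𝒱 n i := by
  induction n with
  | zero =>
    refine le_trans ?_ (le_iSup _ 0)
    unfold symPow
    rw [pow_zero, Submodule.one_le]
    exact one_mem_symDeg
  | succ n ih =>
    unfold symPow at ih ⊢
    rw [pow_succ, Submodule.mul_le]
    rintro a ha _ ⟨v, rfl⟩
    have hv : GradedSym.ι p 𝒱 v ∈ ⨆ j, symDeg p 𝒱 1 j := by
      classical
      rw [← DirectSum.sum_support_decompose 𝒱 v, map_sum]
      refine Submodule.sum_mem _ fun j _ => Submodule.mem_iSup_of_mem j ?_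
      exact Submodule.subset_span ⟨[⟨j, DirectSum.decompose 𝒱 v j⟩], by simp⟩
    have h := Submodule.mul_mem_mul (ih ha) hv
    rw [Submodule.iSup_mul] at h
    refine SetLike.le_def.mp (iSup_le fun i => ?_) h
    rw [Submodule.mul_iSup]
    refine iSup_le fun j => le_trans ?_ (le_iSup _ (i + j))
    rw [Submodule.mul_le]
    exact fun x hx y hy => mul_mem_symDeg hx hy

variable [DecidableEq ℐ] [DirectSum.Decomposition 𝒱]

variable (p 𝒱) in
/-- `v ↦ ∑ᵢ vᵢ tⁱ`. -/
def symCoactι : V →ₗ[ℝ] AddMonoidAlgebra (GradedSym p 𝒱) ℐ :=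
  (DirectSum.toModule ℝ ℐ (AddMonoidAlgebra (GradedSym p 𝒱) ℐ) fun i =>
    (AddMonoidAlgebra.lsingle (R := ℝ) i) ∘ₗ GradedSym.ι p 𝒱 ∘ₗ (𝒱 i).subtype) ∘ₗ
    (DirectSum.decomposeLinearEquiv 𝒱).toLinearMap

theorem symCoactι_of_mem {i : ℐ} {v : V} (hv : v ∈ 𝒱 i) :
    symCoactι p 𝒱 v = AddMonoidAlgebra.single i (GradedSym.ι p 𝒱 v) := by
  lift v to 𝒱 i using hv
  simp [symCoactι]

variable (p 𝒱) in
/-- The coaction `S(V) → S(V)[ℐ]` which encodes the grading. -/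
def symCoact : GradedSym p 𝒱 →ₐ[ℝ] AddMonoidAlgebra (GradedSym p 𝒱) ℐ :=
  (RingQuot.liftAlgHom ℝ ⟨TensorAlgebra.lift ℝ (symCoactι p 𝒱), by
    rintro _ _ ⟨i, j, v, w, hv, hw⟩
    simp only [map_mul, map_smul, TensorAlgebra.lift_ι_apply, symCoactι_of_mem hv,
      symCoactι_of_mem hw, AddMonoidAlgebra.single_mul_single]
    rw [GradedSym.ι_comm hv hw, add_comm j i]
    simp⟩ : RingQuot (SymRel p 𝒱) →ₐ[ℝ] _)

theorem symCoact_ι (v : V) : symCoact p 𝒱 (GradedSym.ι p 𝒱 v) = symCoactι p 𝒱 v :=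
  (RingQuot.liftAlgHom_mkAlgHom_apply _ _ _ _).trans (TensorAlgebra.lift_ι_apply _ _)

theorem symCoact_of_mem {n : ℕ} {i : ℐ} {a : GradedSym p 𝒱} (ha : a ∈ symDeg p 𝒱 n i) :
    symCoact p 𝒱 a = AddMonoidAlgebra.single i a := by
  suffices h : symDeg p 𝒱 n i ≤ LinearMap.eqLocus (symCoact p 𝒱).toLinearMap
      (AddMonoidAlgebra.lsingle (R := ℝ) i) from h ha
  refine Submodule.span_le.mpr ?_
  rintro _ ⟨l, rfl, rfl, rfl⟩
  clear ha
  change symCoact p 𝒱 _ = AddMonoidAlgebra.single _ _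
  induction l with
  | nil => simpa using AddMonoidAlgebra.one_def
  | cons v l ih =>
    simp only [List.map_cons, List.prod_cons, List.sum_cons, map_mul, ih, symCoact_ι,
      symCoactι_of_mem v.2.2, AddMonoidAlgebra.single_mul_single]

variable (p 𝒱) in
/-- The projection of `S(V)` onto its part of degree `i`. -/
def symComponent (i : ℐ) : GradedSym p 𝒱 →ₗ[ℝ] GradedSym p 𝒱 where
  toFun a := (symCoact p 𝒱 a).coeff i
  map_add' a b := by simp
  map_smul' r a := by simp

theorem symComponent_self {n : ℕ} {i : ℐ} {a : GradedSym p 𝒱} (ha : a ∈ symDeg p 𝒱 n i) :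
    symComponent p 𝒱 i a = a := by
  change (symCoact p 𝒱 a).coeff i = a
  simp [symCoact_of_mem ha]

theorem symComponent_ne {n : ℕ} {i j : ℐ} (hij : i ≠ j) {a : GradedSym p 𝒱}
    (ha : a ∈ symDeg p 𝒱 n i) : symComponent p 𝒱 j a = 0 := by
  change (symCoact p 𝒱 a).coeff j = 0
  simp [symCoact_of_mem ha, hij]

theorem symComponent_mem {n : ℕ} (i : ℐ) {a : GradedSym p 𝒱} (ha : a ∈ symPow p 𝒱 n) :
    symComponent p 𝒱 i a ∈ symDeg p 𝒱 n i := by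
  suffices h : symPow p 𝒱 n ≤ (symDeg p 𝒱 n i).comap (symComponent p 𝒱 i) from h ha
  refine (symPow_le_iSup n).trans (iSup_le fun j b hb => ?_)
  rw [Submodule.mem_comap]
  by_cases hij : j = i
  · subst hij
    rwa [symComponent_self hb]
  · rw [symComponent_ne hij hb]
    exact zero_mem _

theorem eq_zero_of_symComponent {n : ℕ} {a : GradedSym p 𝒱} (ha : a ∈ symPow p 𝒱 n)
    (h : ∀ i, symComponent p 𝒱 i a = 0) : a = 0 := by
  obtain ⟨f, hf, rfl⟩ := (Submodule.mem_iSup_iff_exists_finsupp _ _).mp (symPow_le_iSup n ha)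
  refine Finset.sum_eq_zero fun j hj => ?_
  have hc := h j
  rw [Finsupp.sum, map_sum, Finset.sum_eq_single j, symComponent_self (hf j)] at hc
  · exact hc
  · exact fun k _ hkj => symComponent_ne hkj (hf k)
  · exact fun hj' => absurd hj hj'

end SymLemmas

/-! ### Smooth manifolds and graded domains as graded ringed spaces -/

section Spaces

variable (ℐ : Type*) [NonUnitalCommSemiring ℐ]
  (n : ℕ) (N : Type) [TopologicalSpace N] [ChartedSpace (EuclideanSpace ℝ (Fin n)) N]

instance smoothAlgebra (U : (Opens (TopCat.of N))ᵒᵖ) :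
    Algebra ℝ ((smoothSheafRing 𝓘(ℝ, EuclideanSpace ℝ (Fin n)) 𝓘(ℝ, ℝ) N ℝ).presheaf.obj U) :=
  inferInstanceAs
    (Algebra ℝ C^∞⟮𝓘(ℝ, EuclideanSpace ℝ (Fin n)), (unop U : Opens N); 𝓘(ℝ, ℝ), ℝ⟯)

/-- The sheaf `C^∞` of smooth real functions on `N`, concentrated in degree `0`. -/
def smoothGradedSheaf : GradedSheaf ℐ (TopCat.of N) where
  sheaf := smoothSheafRing 𝓘(ℝ, EuclideanSpace ℝ (Fin n)) 𝓘(ℝ, ℝ) N ℝ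
  algebra U := smoothAlgebra n N (op U)
  deg U i :=
    { carrier := {s | i ≠ 0 → s = 0}
      add_mem' := fun ha hb hi => by rw [ha hi, hb hi, add_zero]
      zero_mem' := fun _ => rfl
      smul_mem' := fun r s hs hi => by rw [hs hi, smul_zero] }
  isFormalGrading U :=
    { one_mem := fun h => absurd rfl h
      mul_mem := by
        intro i j a b ha hb hij
        by_cases hi : i = 0
        · have hj : j ≠ 0 := fun hj => hij (by rw [hi, hj, add_zero])
          rw [hb hj, mul_zero]
        · rw [ha hi, zero_mul]
      exists_component := by
        classical
        refine ⟨fun i => if i = 0 then LinearMap.id else 0, fun i a hi => ?_, fun i a ha => ?_,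
          fun i j hij a ha => ?_, fun a ha => ?_⟩
        · simp [hi]
        · by_cases hi : i = 0
          · simp [hi]
          · simp [hi, ha hi]
        · by_cases hj : j = 0
          · have hi : i ≠ 0 := fun hi => hij (hi.trans hj.symm)
            simp [hj, ha hi]
          · simp [hj]
        · simpa using ha 0 }
  map_algebraMap h r := rfl
  map_deg h i s hs hi := by rw [hs hi, map_zero]

/-- The manifold `N`, viewed as the graded ringed space `(N, C^∞)`. -/
def smoothSpace : GradedRingedSpace ℐ := ⟨TopCat.of N, smoothGradedSheaf ℐ n N⟩

variable {ℐ} (p : ℐ →+ ZMod 2) {V : Type} [AddCommGroup V] [Module ℝ V] [FiniteDimensional ℝ V]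
  (𝒱 : ℐ → Submodule ℝ V)

/-- A function on the open set `U` with values in the formal power series `∏ₖ S^k(V)` is smooth if
each of its components, with values in the finite dimensional vector space `S^k(V)`, is smooth,
that is, if its composition with each linear functional is smooth. -/
def IsSmoothFormal {U : Opens N} (f : U → FormalSym p 𝒱) : Prop :=
  ∀ (k : ℕ) (l : Module.Dual ℝ (GradedSym p 𝒱)),
    ContMDiff 𝓘(ℝ, EuclideanSpace ℝ (Fin n)) 𝓘(ℝ, ℝ) ∞
      fun x => l (PowerSeries.coeff k (f x).1)

/-- The algebra of smooth functions on `U` with values in the formal power series `∏ₖ S^k(V)`. -/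
def formalSections (U : Opens N) : Subalgebra ℝ (U → FormalSym p 𝒱) where
  carrier := {f | IsSmoothFormal n N p 𝒱 f}
  mul_mem' := by
    intro f g hf hg k l
    simp only [Pi.mul_apply, MulMemClass.coe_mul, PowerSeries.coeff_mul, map_sum]
    refine contMDiff_finsetSum fun x _ => ?_
    obtain ⟨m, e, d, hd⟩ := symPow_expansion (p := p) (𝒱 := 𝒱) x.1
    have h : ∀ y : U, l (PowerSeries.coeff x.1 (f y).1 * PowerSeries.coeff x.2 (g y).1) =
        ∑ t, d t (PowerSeries.coeff x.1 (f y).1) *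
          (l ∘ₗ LinearMap.mulLeft ℝ (e t)) (PowerSeries.coeff x.2 (g y).1) := by
      intro y
      conv_lhs => rw [hd _ ((f y).2 x.1)]
      simp [Finset.sum_mul]
    simp only [h]
    exact contMDiff_finsetSum fun t _ => (hf x.1 (d t)).mul (hg x.2 _)
  add_mem' := by
    intro f g hf hg k l
    simp only [Pi.add_apply, AddMemClass.coe_add, map_add]
    exact (hf k l).add (hg k l)
  algebraMap_mem' := by
    intro r k l
    exact contMDiff_const (c := l (PowerSeries.coeff k
      (algebraMap ℝ (PowerSeries (GradedSym p 𝒱)) r)))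

/-- The restriction of smooth functions to a smaller open set. -/
def formalRestrict {U W : Opens N} (h : W ≤ U) :
    formalSections n N p 𝒱 U →ₐ[ℝ] formalSections n N p 𝒱 W where
  toFun f := ⟨fun x => f.1 ⟨x.1, h x.2⟩, fun k l => (f.2 k l).comp (contMDiff_inclusion h)⟩
  map_one' := rfl
  map_mul' _ _ := rfl
  map_zero' := rfl
  map_add' _ _ := rfl
  commutes' _ := rfl

/-- The presheaf of smooth functions with values in the formal power series `∏ₖ S^k(V)`. -/
def formalPresheaf : TopCat.Presheaf RingCat.{0} (TopCat.of N) where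
  obj U := RingCat.of (formalSections n N p 𝒱 (unop U))
  map h := RingCat.ofHom (formalRestrict n N p 𝒱 (leOfHom h.unop)).toRingHom
  map_id _ := rfl
  map_comp _ _ := rfl

/-- Smoothness is a local property. -/
def formalLocalPredicate : TopCat.LocalPredicate fun _ : TopCat.of N => FormalSym p 𝒱 where
  pred {U} f := IsSmoothFormal n N p 𝒱 (U := U) f
  res {U W} i f hf := fun k l => (hf k l).comp (contMDiff_inclusion (leOfHom i))
  locality {U} f h := fun k l =>
    ((contDiffWithinAt_localInvariantProp (I := 𝓘(ℝ, EuclideanSpace ℝ (Fin n)))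
      (I' := 𝓘(ℝ, ℝ)) ∞).localPredicate N ℝ).locality _ fun x => by
        obtain ⟨W, hx, i, hW⟩ := h x
        exact ⟨W, hx, i, hW k l⟩

theorem formalPresheaf_isSheaf : (formalPresheaf n N p 𝒱).IsSheaf := by
  unfold TopCat.Presheaf.IsSheaf
  rw [CategoryTheory.Presheaf.isSheaf_iff_isSheaf_forget _ _ (CategoryTheory.forget RingCat)]
  exact (TopCat.subsheafToTypes (formalLocalPredicate n N p 𝒱)).property

/-- The smooth functions all of whose values are homogeneous of degree `i`. -/
def formalDeg (U : Opens N) (i : ℐ) : Submodule ℝ (formalSections n N p 𝒱 U) where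
  carrier := {f | ∀ x k, PowerSeries.coeff k (f.1 x).1 ∈ symDeg p 𝒱 k i}
  add_mem' := by
    intro f g hf hg x k
    exact add_mem (hf x k) (hg x k)
  zero_mem' := by
    intro x k
    exact zero_mem _
  smul_mem' := by
    intro r f hf x k
    exact Submodule.smul_mem _ r (hf x k)

theorem formalDeg_isFormalGrading [DecidableEq ℐ] [DirectSum.Decomposition 𝒱] (U : Opens N) :
    IsFormalGrading (A := formalSections n N p 𝒱 U) (formalDeg n N p 𝒱 U) where
  one_mem := by
    intro x k
    change PowerSeries.coeff k (1 : PowerSeries (GradedSym p 𝒱)) ∈ _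
    rw [PowerSeries.coeff_one]
    split_ifs with h
    · subst h
      exact one_mem_symDeg
    · exact zero_mem _
  mul_mem := by
    intro i j a b ha hb x k
    change PowerSeries.coeff k ((a.1 x).1 * (b.1 x).1) ∈ _
    rw [PowerSeries.coeff_mul]
    refine Submodule.sum_mem _ fun y hy => ?_
    rw [← Finset.HasAntidiagonal.mem_antidiagonal.mp hy]
    exact mul_mem_symDeg (ha x _) (hb x _)
  exists_component := by
    let c : ℐ → formalSections n N p 𝒱 U →ₗ[ℝ] formalSections n N p 𝒱 U := fun i =>
      { toFun := fun f =>
          ⟨fun x => ⟨PowerSeries.mk fun k => symComponent p 𝒱 i (PowerSeries.coeff k (f.1 x).1), by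
            intro k
            rw [PowerSeries.coeff_mk]
            exact symDeg_le (symComponent_mem i ((f.1 x).2 k))⟩, by
            intro k l
            simp only [PowerSeries.coeff_mk]
            exact f.2 k (l ∘ₗ symComponent p 𝒱 i)⟩
        map_add' := by
          intro f g
          ext x k
          simp
        map_smul' := by
          intro r f
          ext x k
          simp }
    have hc : ∀ i f x k, PowerSeries.coeff k ((c i f).1 x).1 =
        symComponent p 𝒱 i (PowerSeries.coeff k (f.1 x).1) := by
      intro i f x k
      exact PowerSeries.coeff_mk k fun k => symComponent p 𝒱 i (PowerSeries.coeff k (f.1 x).1)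
    refine ⟨c, fun i f x k => ?_, fun i f hf => ?_, fun i j hij f hf => ?_, fun f hf => ?_⟩
    · rw [hc]
      exact symComponent_mem i ((f.1 x).2 k)
    · ext x k
      rw [hc, symComponent_self (hf x k)]
    · ext x k
      rw [hc, symComponent_ne hij (hf x k)]
      rfl
    · ext x k
      refine eq_zero_of_symComponent ((f.1 x).2 k) fun i => ?_
      rw [← hc, hf i]
      rfl

/-- The sheaf of smooth functions on `N` with values in `∏ₖ S^k(V)`. -/
def formalGradedSheaf [DecidableEq ℐ] [DirectSum.Decomposition 𝒱] :
    GradedSheaf ℐ (TopCat.of N) where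
  sheaf := ⟨formalPresheaf n N p 𝒱, formalPresheaf_isSheaf n N p 𝒱⟩
  algebra U := inferInstanceAs (Algebra ℝ (formalSections n N p 𝒱 U))
  deg U := formalDeg n N p 𝒱 U
  isFormalGrading U := formalDeg_isFormalGrading n N p 𝒱 U
  map_algebraMap _ _ := rfl
  map_deg h _ _ hs := fun x k => hs ⟨x.1, leOfHom h x.2⟩ k

/-- The graded domain over an open subset `U` of `ℝⁿ`: the graded ringed space of smooth functions
on `U` with values in the algebra of formal power series on `V`. -/
def gradedDomain [DecidableEq ℐ] [DirectSum.Decomposition 𝒱]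
    (U : Opens (EuclideanSpace ℝ (Fin n))) : GradedRingedSpace ℐ :=
  ⟨TopCat.of U, formalGradedSheaf n U p 𝒱⟩

/-- `(M, 𝒪)` is a graded manifold of dimension `n | (dim 𝒱 i)ᵢ` over the smooth manifold `M`: every
point of `M` has an open neighbourhood `U` such that `(U, 𝒪|_U)` is isomorphic, as a graded ringed
space, to a graded domain, the underlying homeomorphism being a diffeomorphism. -/
def IsGradedManifold [DecidableEq ℐ] [DirectSum.Decomposition 𝒱]
    (M : Type) [TopologicalSpace M] [ChartedSpace (EuclideanSpace ℝ (Fin n)) M]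
    (𝒪 : GradedSheaf ℐ (TopCat.of M)) : Prop :=
  ∀ x : M, ∃ U : Opens M, x ∈ U ∧ ∃ (W : Opens (EuclideanSpace ℝ (Fin n)))
    (χ : (⟨TopCat.of U, 𝒪.restrict U⟩ : GradedRingedSpace ℐ) ≅ gradedDomain n p 𝒱 W),
    ContMDiff (M := U) (M' := W) 𝓘(ℝ, EuclideanSpace ℝ (Fin n)) 𝓘(ℝ, EuclideanSpace ℝ (Fin n)) ∞
      (GradedRingedSpace.base χ.hom).hom ∧
    ContMDiff (M := W) (M' := U) 𝓘(ℝ, EuclideanSpace ℝ (Fin n)) 𝓘(ℝ, EuclideanSpace ℝ (Fin n)) ∞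
      (GradedRingedSpace.base χ.inv).hom

end Spaces

end

/-
The stalks of `C^∞`, of the sheaf of a graded domain, and hence of the sheaf of a graded manifold,
carry a local homomorphism `e` to `ℝ`. Such an `e` is the only homomorphism `g` of rings from the
stalk to `ℝ`: the germ `a - g a` is killed by `g`, so it is not a unit, so it is killed by `e`,
whence `e a = g a`, as `ℝ` has no endomorphism but the identity. So every section has values at the
points of its domain, and these are preserved by all morphisms. As smooth functions are determined
by their values, a morphism from `(M, C^∞)` to such a space is determined by its underlying map;
conversely, sending a section to the function of its values is such a morphism over the identity of
`M`.
-/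

noncomputable section

/-! ### Values of sections -/

section Value

open Filter Topology

universe u

theorem ringHom_eq_of_isLocalHom {K A : Type*} [Field K] [Subsingleton (K →+* K)] [Ring A]
    (c : K →+* A) (e : A →+* K) [IsLocalHom e] (g : A →+* K) : g = e := by
  ext a
  have apply_c (f : A →+* K) (r : K) : f (c r) = r :=
    RingHom.congr_fun (Subsingleton.elim (f.comp c) (RingHom.id K)) r
  by_contra hne
  have hunit : IsUnit (a - c (g a)) := by
    refine IsUnit.of_map e _ (IsUnit.mk0 _ ?_)
    rw [map_sub, apply_c, sub_ne_zero]
    exact Ne.symm hne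
  refine (hunit.map g).ne_zero ?_
  rw [map_sub, apply_c, sub_self]

theorem exists_isLocalHom_stalk {X : TopCat.{u}} (F : X.Presheaf RingCat.{u}) (x : X)
    {K : Type u} [DivisionRing K] (e : ∀ U : Opens X, x ∈ U → F.obj (op U) →+* K)
    (e_map : ∀ {U W : Opens X} (h : W ⟶ U) (hx : x ∈ W) (s : F.obj (op U)),
      e W hx (F.map h.op s) = e U (leOfHom h hx) s)
    (isUnit_map : ∀ (U : Opens X) (hx : x ∈ U) (s : F.obj (op U)), e U hx s ≠ 0 →
      ∃ (W : Opens X) (h : W ⟶ U), x ∈ W ∧ IsUnit (F.map h.op s)) :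
    ∃ E : F.stalk x →+* K, IsLocalHom E ∧
      ∀ (U : Opens X) (hx : x ∈ U) (s : F.obj (op U)), E (F.germ U x hx s) = e U hx s := by
  let c : Limits.Cocone ((OpenNhds.inclusion x).op ⋙ F) :=
    { pt := RingCat.of K
      ι := { app := fun U => RingCat.ofHom (e (unop U).1 (unop U).2)
             naturality := fun U W i => by
              ext s
              exact e_map ((OpenNhds.inclusion x).map i.unop) _ s } }
  have germ_desc (U : Opens X) (hx : x ∈ U) (s : F.obj (op U)) :
      (Limits.colimit.desc _ c).hom (F.germ U x hx s) = e U hx s :=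
    ConcreteCategory.congr_hom (Limits.colimit.ι_desc c (op ⟨U, hx⟩)) s
  refine ⟨(Limits.colimit.desc _ c).hom, ⟨fun a ha => ?_⟩, germ_desc⟩
  obtain ⟨U, hx, s, rfl⟩ := F.exists_germ_eq (x := x) a
  obtain ⟨W, h, hxW, hs⟩ := isUnit_map U hx s (germ_desc U hx s ▸ ha.ne_zero)
  rw [← F.germ_res_apply h x hxW]
  exact hs.map (F.germ W x hxW).hom

/-- A space with a sheaf of real rings in which the germs of sections at a point have a value in
`ℝ`, the germs with non-zero value being invertible. -/
structure IsRealValued (X : PresheafedSpace.{u} RingCat.{u}) : Prop where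
  nonempty_ringHom : Nonempty (ℝ →+* X.presheaf.obj (op ⊤))
  exists_isLocalHom : ∀ x : X, ∃ e : X.presheaf.stalk x →+* ℝ, IsLocalHom e

namespace IsRealValued

variable {X Y : PresheafedSpace.{u} RingCat.{u}} (hX : IsRealValued X) (hY : IsRealValued Y)

/-- The value of a germ at `x`, see `eq_value` for its uniqueness. -/
def value (x : X) : X.presheaf.stalk x →+* ℝ := (hX.exists_isLocalHom x).choose

instance isLocalHom_value (x : X) : IsLocalHom (hX.value x) :=
  (hX.exists_isLocalHom x).choose_spec

theorem eq_value {x : X} (e : X.presheaf.stalk x →+* ℝ) : e = hX.value x :=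
  ringHom_eq_of_isLocalHom
    ((X.presheaf.germ ⊤ x trivial).hom.comp hX.nonempty_ringHom.some) (hX.value x) e

theorem value_stalkMap (φ : X ⟶ Y) (x : X) (a : Y.presheaf.stalk (φ.base x)) :
    hX.value x (PresheafedSpace.Hom.stalkMap φ x a) = hY.value (φ.base x) a :=
  RingHom.congr_fun (hY.eq_value ((hX.value x).comp (PresheafedSpace.Hom.stalkMap φ x).hom)) a

include hX hY in
theorem isLocalHom_stalkMap (φ : X ⟶ Y) (x : X) :
    IsLocalHom (PresheafedSpace.Hom.stalkMap φ x).hom := by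
  refine ⟨fun a ha => IsUnit.of_map (hY.value (φ.base x)) a ?_⟩
  rw [← hX.value_stalkMap hY]
  exact ha.map (hX.value x)

theorem of_isLocalHom_stalkMap (hℝ : Nonempty (ℝ →+* Y.presheaf.obj (op ⊤)))
    (h : ∀ y : Y, ∃ (X : PresheafedSpace.{u} RingCat.{u}) (ψ : X ⟶ Y) (x : X), ψ.base x = y ∧
      IsRealValued X ∧ IsLocalHom (PresheafedSpace.Hom.stalkMap ψ x).hom) : IsRealValued Y where
  nonempty_ringHom := hℝ
  exists_isLocalHom y := by
    obtain ⟨X, ψ, x, rfl, hX, hψ⟩ := h y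
    exact ⟨(hX.value x).comp (PresheafedSpace.Hom.stalkMap ψ x).hom, RingHom.isLocalHom_comp _ _⟩

variable {U W : Opens X}

/-- The value of a section at a point of its domain. -/
def evalAt {x : X} (hx : x ∈ U) : X.presheaf.obj (op U) →+* ℝ :=
  (hX.value x).comp (X.presheaf.germ U x hx).hom

/-- The function of the values of a section over `U`, extended by zero to the whole space. -/
def eval (s : X.presheaf.obj (op U)) (x : X) : ℝ :=
  open Classical in if hx : x ∈ U then hX.evalAt hx s else 0

theorem eval_of_mem (s : X.presheaf.obj (op U)) {x : X} (hx : x ∈ U) :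
    hX.eval s x = hX.evalAt hx s :=
  dif_pos hx

theorem eval_of_notMem (s : X.presheaf.obj (op U)) {x : X} (hx : x ∉ U) : hX.eval s x = 0 :=
  dif_neg hx

theorem eval_eq {x : X} (e : X.presheaf.stalk x →+* ℝ) (hx : x ∈ U) (s : X.presheaf.obj (op U)) :
    hX.eval s x = e (X.presheaf.germ U x hx s) := by
  rw [hX.eq_value e]
  exact hX.eval_of_mem s hx

theorem eval_map (h : W ⟶ U) (s : X.presheaf.obj (op U)) {x : X} (hx : x ∈ W) :
    hX.eval (X.presheaf.map h.op s) x = hX.eval s x := by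
  rw [hX.eval_eq (hX.value x) hx, hX.eval_eq (hX.value x) (leOfHom h hx),
    X.presheaf.germ_res_apply]

theorem eval_eventuallyEq {s : X.presheaf.obj (op U)} {t : X.presheaf.obj (op W)} {x : X}
    (hxU : x ∈ U) (hxW : x ∈ W)
    (hst : X.presheaf.germ U x hxU s = X.presheaf.germ W x hxW t) :
    hX.eval s =ᶠ[𝓝 x] hX.eval t := by
  obtain ⟨T, hxT, iU, iW, h⟩ := X.presheaf.germ_eq x hxU hxW s t hst
  filter_upwards [T.2.mem_nhds hxT] with y hy
  rw [← hX.eval_map iU s hy, ← hX.eval_map iW t hy, h]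

theorem eval_app (φ : X ⟶ Y) {U : Opens Y} (s : Y.presheaf.obj (op U)) (x : X) :
    hX.eval (U := (Opens.map φ.base).obj U) (φ.c.app (op U) s) x = hY.eval s (φ.base x) := by
  by_cases hx : φ.base x ∈ U
  · rw [hX.eval_eq (hX.value x) hx, hY.eval_eq (hY.value _) hx, ← hX.value_stalkMap hY φ,
      PresheafedSpace.stalkMap_germ_apply]
  · rw [hX.eval_of_notMem _ hx, hY.eval_of_notMem _ hx]

/-- Sections are determined by their values, as for a sheaf of functions. -/
def SeparatesSections : Prop := ∀ U : Opens X, Function.Injective (hX.eval (U := U))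

namespace SeparatesSections

variable {hX} (sep : hX.SeparatesSections)
include sep

theorem germ_eq {s : X.presheaf.obj (op U)} {t : X.presheaf.obj (op W)} {x : X}
    (hxU : x ∈ U) (hxW : x ∈ W) (hst : hX.eval s =ᶠ[𝓝 x] hX.eval t) :
    X.presheaf.germ U x hxU s = X.presheaf.germ W x hxW t := by
  obtain ⟨T, hT, hT_open, hxT⟩ := mem_nhds_iff.mp hst
  let T' : Opens X := ⟨T, hT_open⟩ ⊓ (U ⊓ W)
  let iU : T' ⟶ U := homOfLE (inf_le_right.trans inf_le_left)
  let iW : T' ⟶ W := homOfLE (inf_le_right.trans inf_le_right)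
  have hres : X.presheaf.map iU.op s = X.presheaf.map iW.op t := by
    refine sep T' (funext fun y => ?_)
    by_cases hy : y ∈ T'
    · rw [hX.eval_map _ _ hy, hX.eval_map _ _ hy]
      exact hT hy.1
    · rw [hX.eval_of_notMem _ hy, hX.eval_of_notMem _ hy]
  have hxT' : x ∈ T' := ⟨hxT, hxU, hxW⟩
  rw [← X.presheaf.germ_res_apply iU x hxT', ← X.presheaf.germ_res_apply iW x hxT', hres]

include hY in
theorem hom_ext {φ ψ : X ⟶ Y} (h : φ.base = ψ.base) : φ = ψ := by
  obtain ⟨b, c⟩ := φ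
  obtain ⟨b', c'⟩ := ψ
  obtain rfl : b = b' := h
  congr 1
  ext U s
  refine sep _ (funext fun x => ?_)
  exact (hX.eval_app hY ⟨b, c⟩ s x).trans (hX.eval_app hY ⟨b, c'⟩ s x).symm

theorem surjective_stalkMap (φ : X ⟶ Y) (x : X)
    (h : ∀ (U : Opens X) (s : X.presheaf.obj (op U)), x ∈ U → ∃ (W : Opens Y)
      (t : Y.presheaf.obj (op W)), φ.base x ∈ W ∧ hY.eval t ∘ φ.base =ᶠ[𝓝 x] hX.eval s) :
    Function.Surjective (PresheafedSpace.Hom.stalkMap φ x) := by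
  intro a
  obtain ⟨U, hx, s, rfl⟩ := X.presheaf.exists_germ_eq (x := x) a
  obtain ⟨W, t, hxW, hts⟩ := h U s hx
  refine ⟨Y.presheaf.germ W (φ.base x) hxW t, ?_⟩
  rw [PresheafedSpace.stalkMap_germ_apply]
  refine sep.germ_eq (U := (Opens.map φ.base).obj W) hxW hx (.trans (.of_eq ?_) hts)
  exact funext (hX.eval_app hY φ t)

end SeparatesSections

end IsRealValued

end Value

/-! ### Smooth functions -/

section Smooth

theorem exists_opens_ne_zero {X R : Type*} [TopologicalSpace X] [TopologicalSpace R] [T1Space R]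
    [Zero R] {U : Opens X} {f : U → R} (hf : Continuous f) {x : X} (hx : x ∈ U)
    (hfx : f ⟨x, hx⟩ ≠ 0) :
    ∃ (W : Opens X) (h : W ≤ U), x ∈ W ∧ ∀ y : W, f (Set.inclusion h y) ≠ 0 := by
  refine ⟨⟨Subtype.val '' (f ⁻¹' {0}ᶜ), U.2.isOpenMap_subtype_val _
    (isOpen_compl_singleton.preimage hf)⟩, ?_, ⟨⟨x, hx⟩, hfx, rfl⟩, ?_⟩
  · rintro _ ⟨y, -, rfl⟩
    exact y.2
  · rintro ⟨_, y, hy, rfl⟩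
    exact hy

variable {E H : Type*} [NormedAddCommGroup E] [NormedSpace ℝ E] [TopologicalSpace H]
  (I : ModelWithCorners ℝ E H) (M : Type) [TopologicalSpace M] [ChartedSpace H M]

/-- The manifold `M` as a space with a sheaf of rings, for an arbitrary model `I`. -/
abbrev smoothPresheafedSpace : PresheafedSpace RingCat.{0} :=
  ⟨TopCat.of M, (smoothSheafRing I 𝓘(ℝ, ℝ) M ℝ).presheaf⟩

variable {I M}

theorem exists_isLocalHom_stalk_smooth (x : M) :
    ∃ e : (smoothPresheafedSpace I M).presheaf.stalk x →+* ℝ, IsLocalHom e ∧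
      ∀ (U : Opens M) (hx : x ∈ U) (f : C^∞⟮I, U; 𝓘(ℝ, ℝ), ℝ⟯),
        e ((smoothPresheafedSpace I M).presheaf.germ U x hx f) = f ⟨x, hx⟩ := by
  refine exists_isLocalHom_stalk (smoothPresheafedSpace I M).presheaf x
    (fun (U : Opens M) hx => ContMDiffMap.evalRingHom (I := I) (n := ∞) (⟨x, hx⟩ : U))
    (fun _ _ _ => rfl) fun (U : Opens M) hx s hs => ?_
  let f : C^∞⟮I, U; 𝓘(ℝ, ℝ), ℝ⟯ := s
  obtain ⟨W, h, hxW, hW⟩ := exists_opens_ne_zero f.contMDiff.continuous hx hs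
  let g : C^∞⟮I, W; 𝓘(ℝ, ℝ), ℝ⟯ :=
    ⟨fun y => (f (Set.inclusion h y))⁻¹, (f.contMDiff.comp (contMDiff_inclusion h)).inv₀ hW⟩
  refine ⟨W, homOfLE h, hxW, ⟨_, g, ?_, ?_⟩, rfl⟩
  · exact Subtype.ext (funext fun y => mul_inv_cancel₀ (hW y))
  · exact Subtype.ext (funext fun y => inv_mul_cancel₀ (hW y))

theorem isRealValued_smooth : IsRealValued (smoothPresheafedSpace I M) where
  nonempty_ringHom := ⟨algebraMap ℝ C^∞⟮I, (⊤ : Opens M); 𝓘(ℝ, ℝ), ℝ⟯⟩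
  exists_isLocalHom x := (exists_isLocalHom_stalk_smooth x).imp fun _ h => h.1

theorem eval_smooth {U : Opens M} (f : C^∞⟮I, U; 𝓘(ℝ, ℝ), ℝ⟯) {x : M} (hx : x ∈ U) :
    isRealValued_smooth.eval (X := smoothPresheafedSpace I M) f x = f ⟨x, hx⟩ := by
  obtain ⟨e, -, e_germ⟩ := exists_isLocalHom_stalk_smooth (I := I) x
  exact (isRealValued_smooth.eval_eq e hx _).trans (e_germ U hx f)

theorem contMDiffOn_eval_smooth {U : Opens M} (f : C^∞⟮I, U; 𝓘(ℝ, ℝ), ℝ⟯) :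
    ContMDiffOn (M := M) I 𝓘(ℝ, ℝ) ∞
      (isRealValued_smooth.eval (X := smoothPresheafedSpace I M) f) U := by
  refine fun x hx => (contMDiffAt_subtype_iff (x := (⟨x, hx⟩ : U)).mp ?_).contMDiffWithinAt
  exact (f.contMDiff ⟨x, hx⟩).congr_of_eventuallyEq (.of_eq (funext fun y => eval_smooth f y.2))

theorem separatesSections_smooth :
    (isRealValued_smooth (I := I) (M := M)).SeparatesSections := by
  refine fun (U : Opens M) f g hfg => Subtype.ext (funext fun x => ?_)
  exact (eval_smooth f x.2).symm.trans ((congrFun hfg x.1).trans (eval_smooth g x.2))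

theorem smoothSheafRing_hom_eq_id
    (F : smoothSheafRing I 𝓘(ℝ, ℝ) M ℝ ⟶ smoothSheafRing I 𝓘(ℝ, ℝ) M ℝ) : F = 𝟙 _ := by
  let φ : smoothPresheafedSpace I M ⟶ smoothPresheafedSpace I M := ⟨𝟙 _, F.hom⟩
  have hφ : φ = 𝟙 _ := separatesSections_smooth.hom_ext isRealValued_smooth rfl
  exact ObjectProperty.hom_ext _ (eq_of_heq (PresheafedSpace.Hom.mk.inj hφ).2)

end Smooth

/-! ### Morphisms from a manifold to a sheaf of graded algebras -/

namespace GradedRingedSpace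

variable {ℐ : Type*} [AddCommMonoid ℐ] {X Y : GradedRingedSpace ℐ}

theorem hom_ext {φ ψ : X ⟶ Y} (h : φ.toHom = ψ.toHom) : φ = ψ := by
  obtain ⟨f, hf⟩ := φ
  obtain ⟨g, hg⟩ := ψ
  obtain rfl : f = g := h
  rfl

/-- The faithful functor which forgets the gradings and the multiplication by real scalars. -/
def forgetGrading : GradedRingedSpace ℐ ⥤ SheafedSpace RingCat.{0} where
  obj X := X.toSheafedSpace
  map φ := InducedCategory.homMk φ.toHom

instance : (forgetGrading (ℐ := ℐ)).Faithful where
  map_injective h := hom_ext (congrArg InducedCategory.Hom.hom h)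

theorem mono_of_isStalkSurjective {φ : X ⟶ Y} (hφ : Function.Injective (base φ))
    (hφ' : IsStalkSurjective φ) : Mono φ := by
  have : Mono (forgetGrading.map φ) := SheafedSpace.mono_of_base_injective_of_stalk_epi _ hφ
    fun x => ConcreteCategory.epi_of_surjective _ (hφ' x)
  exact forgetGrading.mono_of_mono_map this

end GradedRingedSpace

section SmoothlyValued

open Filter Topology

variable {ℐ E H : Type*} [NormedAddCommGroup E] [NormedSpace ℝ E] [TopologicalSpace H]
  (I : ModelWithCorners ℝ E H) {M : Type} [TopologicalSpace M] [ChartedSpace H M]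

/-- The space underlying a sheaf of graded algebras, without the grading. -/
abbrev GradedSheaf.toPresheafedSpace [AddCommMonoid ℐ] {X : TopCat.{0}} (𝒪 : GradedSheaf ℐ X) :
    PresheafedSpace RingCat.{0} :=
  (⟨X, 𝒪⟩ : GradedRingedSpace ℐ).toSheafedSpace.toPresheafedSpace

/-- A sheaf of graded algebras on the manifold `M` whose sections have values in `ℝ` such that the
functions arising as values are locally the smooth ones, and homogeneous sections of non-zero degree
have value zero. -/
structure IsSmoothlyValued [AddCommMonoid ℐ] (𝒪 : GradedSheaf ℐ (TopCat.of M)) : Prop where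
  isRealValued : IsRealValued 𝒪.toPresheafedSpace
  eval_of_mem_deg : ∀ {U : Opens M} {i : ℐ}, i ≠ 0 → ∀ s ∈ 𝒪.deg U i, isRealValued.eval s = 0
  contMDiffOn_eval : ∀ {U : Opens M} (s : 𝒪.sheaf.presheaf.obj (op U)),
    ContMDiffOn (M := M) I 𝓘(ℝ, ℝ) ∞ (isRealValued.eval s) U
  exists_eval_eventuallyEq : ∀ (x : M) (f : M → ℝ), (∀ᶠ y in 𝓝 x, ContMDiffAt I 𝓘(ℝ, ℝ) ∞ f y) →
    ∃ (U : Opens M) (s : 𝒪.sheaf.presheaf.obj (op U)), x ∈ U ∧ isRealValued.eval s =ᶠ[𝓝 x] f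

namespace IsSmoothlyValued

variable {I} [AddCommMonoid ℐ] {𝒪 : GradedSheaf ℐ (TopCat.of M)} (h : IsSmoothlyValued I 𝒪)

/-- The value functions of the sections over `U`. -/
def toSmooth (U : Opens M) : 𝒪.sheaf.presheaf.obj (op U) →+* C^∞⟮I, U; 𝓘(ℝ, ℝ), ℝ⟯ where
  toFun s := ⟨fun x => h.isRealValued.evalAt x.2 s, by
    have heval : (fun x : U => h.isRealValued.evalAt x.2 s) =
        fun x : U => h.isRealValued.eval s x.1 :=
      funext fun x => (h.isRealValued.eval_of_mem s x.2).symm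
    rw [heval]
    exact fun x => contMDiffAt_subtype_iff.mpr
      ((h.contMDiffOn_eval s).contMDiffAt (U.2.mem_nhds x.2))⟩
  map_one' := Subtype.ext (funext fun x => map_one (h.isRealValued.evalAt x.2))
  map_mul' s t := Subtype.ext (funext fun x => map_mul (h.isRealValued.evalAt x.2) s t)
  map_zero' := Subtype.ext (funext fun x => map_zero (h.isRealValued.evalAt x.2))
  map_add' s t := Subtype.ext (funext fun x => map_add (h.isRealValued.evalAt x.2) s t)

theorem toSmooth_apply {U : Opens M} (s : 𝒪.sheaf.presheaf.obj (op U)) (x : U) :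
    h.toSmooth U s x = h.isRealValued.eval s x.1 :=
  (h.isRealValued.eval_of_mem s x.2).symm

end IsSmoothlyValued

end SmoothlyValued

section Euclidean

variable {ℐ : Type*} [NonUnitalCommSemiring ℐ] {n : ℕ} {M : Type} [TopologicalSpace M]
  [ChartedSpace (EuclideanSpace ℝ (Fin n)) M] {𝒪 : GradedSheaf ℐ (TopCat.of M)}

namespace IsSmoothlyValued

open GradedRingedSpace

variable (h : IsSmoothlyValued 𝓘(ℝ, EuclideanSpace ℝ (Fin n)) 𝒪)

/-- The morphism which sends a section to the function of its values. -/
def evalHom : smoothSpace ℐ n M ⟶ ⟨TopCat.of M, 𝒪⟩ where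
  toHom :=
    { base := 𝟙 (TopCat.of M)
      c :=
        { app U := RingCat.ofHom (S := (smoothGradedSheaf ℐ n M).sheaf.presheaf.obj U)
            (h.toSmooth (unop U))
          naturality U W i := by
            ext s
            refine Subtype.ext (funext fun x => ?_)
            exact (h.toSmooth_apply _ x).trans
              ((h.isRealValued.eval_map i.unop s x.2).trans
                (h.toSmooth_apply s ⟨x, leOfHom i.unop x.2⟩).symm) } }
  map_deg U i s hs hi := Subtype.ext (funext fun x =>
    (h.toSmooth_apply s x).trans (congrFun (h.eval_of_mem_deg hi s hs) x.1))

theorem isRealLinear_evalHom : IsRealLinear h.evalHom := by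
  refine fun (U : Opens (TopCat.of M)) r => Subtype.ext (funext fun x => ?_)
  exact RingHom.congr_fun (Subsingleton.elim
    ((h.isRealValued.evalAt x.2).comp (𝒪.algebra U).algebraMap) (RingHom.id ℝ)) r

theorem isLocal_evalHom : IsLocal h.evalHom :=
  isRealValued_smooth.isLocalHom_stalkMap h.isRealValued h.evalHom.toHom

theorem isStalkSurjective_evalHom : IsStalkSurjective h.evalHom := by
  refine fun (x : M) => separatesSections_smooth.surjective_stalkMap h.isRealValued
    h.evalHom.toHom x fun (U : Opens M) f hx => ?_
  refine h.exists_eval_eventuallyEq x (isRealValued_smooth.eval f) ?_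
  filter_upwards [U.2.mem_nhds hx] with y hy
  exact (contMDiffOn_eval_smooth f).contMDiffAt (U.2.mem_nhds hy)

theorem mono_evalHom : Mono h.evalHom :=
  mono_of_isStalkSurjective Function.injective_id h.isStalkSurjective_evalHom

theorem eq_evalHom (ψ : smoothSpace ℐ n M ⟶ ⟨TopCat.of M, 𝒪⟩) (hψ : base ψ = 𝟙 (TopCat.of M)) :
    ψ = h.evalHom :=
  hom_ext (separatesSections_smooth.hom_ext h.isRealValued hψ)

include h in
theorem exists_unique_hom :
    ∃ φ : smoothSpace ℐ n M ⟶ (⟨TopCat.of M, 𝒪⟩ : GradedRingedSpace ℐ),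
      base φ = 𝟙 (TopCat.of M) ∧ Mono φ ∧ IsLocal φ ∧ IsRealLinear φ ∧ IsStalkSurjective φ ∧
      ∀ ψ : smoothSpace ℐ n M ⟶ (⟨TopCat.of M, 𝒪⟩ : GradedRingedSpace ℐ),
        base ψ = 𝟙 (TopCat.of M) → ψ = φ :=
  ⟨h.evalHom, rfl, h.mono_evalHom, h.isLocal_evalHom, h.isRealLinear_evalHom,
    h.isStalkSurjective_evalHom, h.eq_evalHom⟩

end IsSmoothlyValued

end Euclidean

/-! ### Locality -/

section LocalDiffeomorphism

open Filter Topology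

variable {E H : Type*} [NormedAddCommGroup E] [NormedSpace ℝ E] [TopologicalSpace H]
  (I : ModelWithCorners ℝ E H) {M : Type*} [TopologicalSpace M] [ChartedSpace H M]

theorem isLocalDiffeomorph_subtype_val (n : ℕ∞ω) (U : Opens M) :
    IsLocalDiffeomorph I I n (Subtype.val : U → M) := by
  intro x
  let e := U.openPartialHomeomorphSubtypeCoe ⟨x⟩
  refine ⟨{ toPartialEquiv := e.toPartialEquiv
            open_source := e.open_source
            open_target := e.open_target
            contMDiffOn_toFun := contMDiff_subtype_val.contMDiffOn
            contMDiffOn_invFun := fun y hy => ?_ }, trivial, fun _ _ => rfl⟩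
  have hyU : y ∈ U := by simpa [e] using hy
  refine ((contMDiffAt_subtype_iff (x := ⟨y, hyU⟩)).mp ?_).contMDiffWithinAt
  exact contMDiffAt_id.congr_of_eventuallyEq (.of_eq (funext fun z => e.left_inv trivial))

variable {I} {E' H' F G P Q : Type*} [NormedAddCommGroup E'] [NormedSpace ℝ E']
  [TopologicalSpace H'] {J : ModelWithCorners ℝ E' H'} {N : Type*} [TopologicalSpace N]
  [ChartedSpace H' N] {n : ℕ∞ω} {g : N → M} {w : N}

theorem eventually_isLocalDiffeomorphAt (hg : IsLocalDiffeomorphAt J I n g w) :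
    ∀ᶠ y in 𝓝 w, IsLocalDiffeomorphAt J I n g y := by
  obtain ⟨Φ, hw, hΦ⟩ := hg
  filter_upwards [Φ.open_source.mem_nhds hw] with y hy
  exact ⟨Φ, hy, hΦ⟩

theorem tendsto_localInverse (hg : IsLocalDiffeomorphAt J I n g w) :
    Tendsto hg.localInverse (𝓝 (g w)) (𝓝 w) := by
  have h := hg.localInverse_contMDiffAt.continuousAt.tendsto
  rwa [hg.localInverse_left_inv hg.localInverse_mem_target] at h

theorem eventuallyEq_of_comp_localDiffeomorphAt (hg : IsLocalDiffeomorphAt J I n g w)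
    {f f' : M → P} (h : f ∘ g =ᶠ[𝓝 w] f' ∘ g) : f =ᶠ[𝓝 (g w)] f' := by
  filter_upwards [(tendsto_localInverse hg).eventually h, hg.localInverse_eventuallyEq_right]
    with y hy hgy
  simpa only [Function.comp_apply, show g (hg.localInverse y) = y from hgy] using hy

theorem contMDiffAt_of_comp_localDiffeomorphAt [NormedAddCommGroup F] [NormedSpace ℝ F]
    [TopologicalSpace G] {K : ModelWithCorners ℝ F G} [TopologicalSpace Q] [ChartedSpace G Q]
    (hg : IsLocalDiffeomorphAt J I n g w) {f : M → Q} (h : ContMDiffAt J K n (f ∘ g) w) :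
    ContMDiffAt I K n f (g w) := by
  have hw : hg.localInverse (g w) = w := hg.localInverse_left_inv hg.localInverse_mem_target
  have hcomp : ContMDiffAt I K n (f ∘ g ∘ hg.localInverse) (g w) :=
    ContMDiffAt.comp (g w) (g := f ∘ g) (by rwa [hw]) hg.localInverse_contMDiffAt
  exact hcomp.congr_of_eventuallyEq (hg.localInverse_eventuallyEq_right.symm.fun_comp f)

end LocalDiffeomorphism

section Restrict

variable {ℐ : Type*} [AddCommMonoid ℐ] {X : TopCat.{0}}

/-- The inclusion of an open subspace. -/
def GradedSheaf.ofRestrict (𝒪 : GradedSheaf ℐ X) (U : Opens X) :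
    (⟨TopCat.of U, 𝒪.restrict U⟩ : GradedRingedSpace ℐ) ⟶ ⟨X, 𝒪⟩ where
  toHom := PresheafedSpace.ofRestrict 𝒪.toPresheafedSpace
    (f := TopCat.ofHom ⟨_, continuous_subtype_val⟩) U.isOpenEmbedding
  map_deg W i s hs :=
    𝒪.map_deg (U.isOpenEmbedding.isOpenMap.adjunction.counit.app W) i s hs

instance (𝒪 : GradedSheaf ℐ X) (U : Opens X) :
    PresheafedSpace.IsOpenImmersion (𝒪.ofRestrict U).toHom :=
  PresheafedSpace.IsOpenImmersion.ofRestrict 𝒪.toPresheafedSpace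
    (f := TopCat.ofHom ⟨_, continuous_subtype_val⟩) U.isOpenEmbedding

namespace GradedRingedSpace

variable {X Y : GradedRingedSpace ℐ}

theorem bijective_stalkMap (φ : X ⟶ Y) [PresheafedSpace.IsOpenImmersion φ.toHom] (x : X.carrier) :
    Function.Bijective (stalkMap φ x) := by
  have : IsIso (PresheafedSpace.Hom.stalkMap φ.toHom x) :=
    PresheafedSpace.IsOpenImmersion.stalk_iso φ.toHom x
  exact ConcreteCategory.bijective_of_isIso (PresheafedSpace.Hom.stalkMap φ.toHom x)

instance (φ : X ≅ Y) : PresheafedSpace.IsOpenImmersion φ.hom.toHom := by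
  have : IsIso φ.hom.toHom :=
    ⟨φ.inv.toHom, congrArg Hom.toHom φ.hom_inv_id, congrArg Hom.toHom φ.inv_hom_id⟩
  infer_instance

end GradedRingedSpace

end Restrict

section Cover

open Filter Topology GradedRingedSpace

variable {ℐ : Type*} [AddCommMonoid ℐ]

namespace IsSmoothlyValued

variable {E H E' H' : Type*} [NormedAddCommGroup E] [NormedSpace ℝ E] [TopologicalSpace H]
  [NormedAddCommGroup E'] [NormedSpace ℝ E'] [TopologicalSpace H']
  {I : ModelWithCorners ℝ E H} {J : ModelWithCorners ℝ E' H'}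
  {M : Type} [TopologicalSpace M] [ChartedSpace H M]
  {N : Type} [TopologicalSpace N] [ChartedSpace H' N]
  {𝒪 : GradedSheaf ℐ (TopCat.of M)} {𝒪' : GradedSheaf ℐ (TopCat.of N)}
  (hM : IsRealValued 𝒪.toPresheafedSpace) (hN : IsSmoothlyValued J 𝒪')
  (ψ : (⟨TopCat.of N, 𝒪'⟩ : GradedRingedSpace ℐ) ⟶ ⟨TopCat.of M, 𝒪⟩) {w : N}
  (hψ : IsLocalDiffeomorphAt J I ∞ (M := N) (N := M) (base ψ) w)

include hN hψ in
theorem contMDiffAt_eval_base {U : Opens M} (hw : base ψ w ∈ U)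
    (s : 𝒪.sheaf.presheaf.obj (op U)) :
    ContMDiffAt (M := M) I 𝓘(ℝ, ℝ) ∞ (hM.eval s) (base ψ w) := by
  refine contMDiffAt_of_comp_localDiffeomorphAt hψ ?_
  refine ((hN.contMDiffOn_eval (app ψ U s)).contMDiffAt
    (((Opens.map (base ψ)).obj U).2.mem_nhds hw)).congr_of_eventuallyEq (.of_eq ?_)
  exact funext fun y => (hN.isRealValued.eval_app hM ψ.toHom s y).symm

include hN hψ in
theorem exists_eval_eventuallyEq_base (hψ' : Function.Surjective (stalkMap ψ w)) {f : M → ℝ}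
    (hf : ∀ᶠ y in 𝓝 (base ψ w : M), ContMDiffAt I 𝓘(ℝ, ℝ) ∞ f y) :
    ∃ (U : Opens M) (s : 𝒪.sheaf.presheaf.obj (op U)),
      base ψ w ∈ U ∧ hM.eval s =ᶠ[𝓝 (base ψ w : M)] f := by
  have hfψ : ∀ᶠ y in 𝓝 w, ContMDiffAt J 𝓘(ℝ, ℝ) ∞ (f ∘ base ψ) y := by
    filter_upwards [hψ.contMDiffAt.continuousAt.eventually hf,
      eventually_isLocalDiffeomorphAt hψ] with y hfy hy
    exact hfy.comp y hy.contMDiffAt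
  obtain ⟨W, t, hw, ht⟩ := hN.exists_eval_eventuallyEq w _ hfψ
  obtain ⟨a, ha⟩ := hψ' (𝒪'.sheaf.presheaf.germ W w hw t)
  obtain ⟨U, hwU, s, rfl⟩ := 𝒪.sheaf.presheaf.exists_germ_eq (x := base ψ w) a
  refine ⟨U, s, hwU, eventuallyEq_of_comp_localDiffeomorphAt hψ (.trans ?_ ht)⟩
  have hgerm : 𝒪'.sheaf.presheaf.germ ((Opens.map (base ψ)).obj U) w hwU (app ψ U s) =
      𝒪'.sheaf.presheaf.germ W w hw t :=
    (PresheafedSpace.stalkMap_germ_apply ψ.toHom U w hwU s).symm.trans ha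
  refine .trans (.of_eq ?_) (hN.isRealValued.eval_eventuallyEq hwU hw hgerm)
  exact funext fun y => (hN.isRealValued.eval_app hM ψ.toHom s y).symm

theorem of_charts (h : ∀ x : M, ∃ (N : Type) (_ : TopologicalSpace N) (_ : ChartedSpace H' N)
      (𝒪' : GradedSheaf ℐ (TopCat.of N))
      (ψ : (⟨TopCat.of N, 𝒪'⟩ : GradedRingedSpace ℐ) ⟶ ⟨TopCat.of M, 𝒪⟩) (w : N),
      base ψ w = x ∧ IsSmoothlyValued J 𝒪' ∧ Function.Bijective (stalkMap ψ w) ∧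
      IsLocalDiffeomorphAt J I ∞ (M := N) (N := M) (base ψ) w) :
    IsSmoothlyValued I 𝒪 := by
  have hM : IsRealValued 𝒪.toPresheafedSpace := by
    refine .of_isLocalHom_stalkMap ⟨(𝒪.algebra ⊤).algebraMap⟩ fun x => ?_
    obtain ⟨N, _, _, 𝒪', ψ, w, hw, hN, hψ, -⟩ := h x
    exact ⟨_, ψ.toHom, w, hw, hN.isRealValued,
      isLocalHom_toRingHom (RingEquiv.ofBijective (stalkMap ψ w) hψ)⟩
  refine ⟨hM, fun {U i} hi s hs => funext fun x => ?_, fun {U} s x hx => ?_, fun x f hf => ?_⟩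
  · obtain ⟨N, _, _, 𝒪', ψ, w, rfl, hN, -, -⟩ := h x
    exact (hN.isRealValued.eval_app hM ψ.toHom s w).symm.trans
      (congrFun (hN.eval_of_mem_deg hi _ (ψ.map_deg U i s hs)) w)
  · obtain ⟨N, _, _, 𝒪', ψ, w, rfl, hN, -, hψ⟩ := h x
    exact (hN.contMDiffAt_eval_base hM ψ hψ hx s).contMDiffWithinAt
  · obtain ⟨N, _, _, 𝒪', ψ, w, rfl, hN, hψ', hψ⟩ := h x
    exact hN.exists_eval_eventuallyEq_base hM ψ hψ hψ'.2 hf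

theorem of_local_iso (h : ∀ x : M, ∃ U : Opens M, x ∈ U ∧ ∃ (N : Type) (_ : TopologicalSpace N)
      (_ : ChartedSpace H' N) (𝒪' : GradedSheaf ℐ (TopCat.of N))
      (χ : (⟨TopCat.of U, 𝒪.restrict U⟩ : GradedRingedSpace ℐ) ≅ ⟨TopCat.of N, 𝒪'⟩),
      IsSmoothlyValued J 𝒪' ∧ ContMDiff (M := U) (M' := N) I J ∞ (base χ.hom).hom ∧
      ContMDiff (M := N) (M' := U) J I ∞ (base χ.inv).hom) :
    IsSmoothlyValued I 𝒪 := by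
  refine .of_charts (J := J) fun x => ?_
  obtain ⟨U, hx, N, _, _, 𝒪', χ, hN, hχ, hχ'⟩ := h x
  have left_inv (u : U) : base χ.inv (base χ.hom u) = u :=
    ConcreteCategory.congr_hom (congrArg base χ.hom_inv_id) u
  let e : Diffeomorph J I N U ∞ :=
    { toFun := (base χ.inv).hom
      invFun := (base χ.hom).hom
      left_inv := ConcreteCategory.congr_hom (congrArg base χ.inv_hom_id)
      right_inv := left_inv
      contMDiff_toFun := hχ'
      contMDiff_invFun := hχ }
  have : PresheafedSpace.IsOpenImmersion (χ.inv ≫ 𝒪.ofRestrict U).toHom :=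
    inferInstanceAs (PresheafedSpace.IsOpenImmersion (χ.symm.hom.toHom ≫ (𝒪.ofRestrict U).toHom))
  refine ⟨N, _, _, 𝒪', χ.inv ≫ 𝒪.ofRestrict U, base χ.hom ⟨x, hx⟩, ?_, hN,
    bijective_stalkMap _ _, ?_⟩
  · exact congrArg Subtype.val (left_inv ⟨x, hx⟩)
  · exact (e.isLocalDiffeomorph _).comp I M (isLocalDiffeomorph_subtype_val I ∞ U _)

end IsSmoothlyValued

end Cover

/-! ### Graded domains -/

section Formal

theorem coeff_invOfUnit_mem {R σ : Type*} [Ring R] [SetLike σ R] [AddSubgroupClass σ R]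
    (C : ℕ → σ) [SetLike.GradedMul C] {f : PowerSeries R} (hf : ∀ k, PowerSeries.coeff k f ∈ C k)
    {u : Rˣ} (hu : (↑u⁻¹ : R) ∈ C 0) (k : ℕ) : PowerSeries.coeff k (f.invOfUnit u) ∈ C k := by
  induction k using Nat.strong_induction_on with
  | _ k ih =>
    rw [PowerSeries.coeff_invOfUnit]
    split_ifs with hk
    · rwa [hk]
    · suffices hsum : _ ∈ C k by
        simpa only [zero_add] using SetLike.mul_mem_graded (neg_mem hu) hsum
      refine sum_mem fun x hx => ?_
      split_ifs with hxk
      · rw [← Finset.HasAntidiagonal.mem_antidiagonal.mp hx]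
        exact SetLike.mul_mem_graded (hf x.1) (ih x.2 hxk)
      · exact zero_mem _

variable {ℐ : Type*} [NonUnitalCommSemiring ℐ] (p : ℐ →+ ZMod 2)
  {V : Type} [AddCommGroup V] [Module ℝ V] (𝒱 : ℐ → Submodule ℝ V)

/-- The augmentation `S(V) → ℝ`, which sends `V` to `0`. -/
def GradedSym.augmentation : GradedSym p 𝒱 →ₐ[ℝ] ℝ :=
  (RingQuot.liftAlgHom ℝ ⟨TensorAlgebra.lift ℝ (0 : V →ₗ[ℝ] ℝ), by
    rintro _ _ ⟨i, j, v, w, hv, hw⟩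
    simp⟩ : RingQuot (SymRel p 𝒱) →ₐ[ℝ] ℝ)

/-- The body of a formal power series on `V`: its component in `S⁰(V) = ℝ`. -/
def FormalSym.body : FormalSym p 𝒱 →+* ℝ :=
  ((GradedSym.augmentation p 𝒱 : GradedSym p 𝒱 →+* ℝ).comp PowerSeries.constantCoeff).comp
    (FormalSym p 𝒱).val.toRingHom

variable {p 𝒱}

theorem GradedSym.algebraMap_augmentation {a : GradedSym p 𝒱} (ha : a ∈ symPow p 𝒱 0) :
    algebraMap ℝ (GradedSym p 𝒱) (GradedSym.augmentation p 𝒱 a) = a := by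
  rw [symPow, pow_zero, Submodule.mem_one] at ha
  obtain ⟨r, rfl⟩ := ha
  rw [AlgHom.commutes, Algebra.algebraMap_self_apply]

theorem symDeg_zero_of_ne {i : ℐ} (hi : i ≠ 0) : symDeg p 𝒱 0 i = ⊥ := by
  refine Submodule.span_eq_bot.mpr ?_
  rintro _ ⟨l, hl, rfl, -⟩
  rw [List.eq_nil_of_length_eq_zero hl] at hi
  exact absurd rfl hi

theorem FormalSym.body_apply (f : FormalSym p 𝒱) :
    FormalSym.body p 𝒱 f = GradedSym.augmentation p 𝒱 (PowerSeries.coeff 0 f.1) :=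
  congrArg (GradedSym.augmentation p 𝒱) (PowerSeries.coeff_zero_eq_constantCoeff_apply _).symm

theorem FormalSym.body_algebraMap (r : ℝ) : FormalSym.body p 𝒱 (algebraMap ℝ _ r) = r :=
  RingHom.congr_fun (Subsingleton.elim ((FormalSym.body p 𝒱).comp (algebraMap ℝ _)) (.id ℝ)) r

theorem FormalSym.algebraMap_body (f : FormalSym p 𝒱) :
    algebraMap ℝ (GradedSym p 𝒱) (FormalSym.body p 𝒱 f) = PowerSeries.constantCoeff f.1 := by
  rw [body_apply, GradedSym.algebraMap_augmentation (f.2 0),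
    PowerSeries.coeff_zero_eq_constantCoeff_apply]

section SmoothSymPow

variable {E H : Type*} [NormedAddCommGroup E] [NormedSpace ℝ E] [TopologicalSpace H]
  (I : ModelWithCorners ℝ E H) (N : Type*) [TopologicalSpace N] [ChartedSpace H N]

variable (p 𝒱) in
/-- The smooth functions with values in `S^k(V)`. -/
def smoothSymPow (k : ℕ) : Submodule ℝ (N → GradedSym p 𝒱) where
  carrier := {a | (∀ x, a x ∈ symPow p 𝒱 k) ∧
    ∀ l : Module.Dual ℝ (GradedSym p 𝒱), ContMDiff I 𝓘(ℝ, ℝ) ∞ fun x => l (a x)}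
  add_mem' ha hb := by
    refine ⟨fun x => add_mem (ha.1 x) (hb.1 x), fun l => ?_⟩
    simp only [Pi.add_apply, map_add]
    exact (ha.2 l).add (hb.2 l)
  zero_mem' := by
    refine ⟨fun _ => zero_mem _, fun l => ?_⟩
    simp only [Pi.zero_apply, map_zero]
    exact contMDiff_const
  smul_mem' r a ha := by
    refine ⟨fun x => Submodule.smul_mem _ r (ha.1 x), fun l => ?_⟩
    simp only [Pi.smul_apply, map_smul]
    exact contMDiff_const.mul (ha.2 l)

instance [FiniteDimensional ℝ V] : SetLike.GradedMul (smoothSymPow p 𝒱 I N) where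
  mul_mem := by
    intro i j a b ha hb
    refine ⟨fun x => ?_, fun l => ?_⟩
    · rw [symPow, pow_add]
      exact Submodule.mul_mem_mul (ha.1 x) (hb.1 x)
    · obtain ⟨m, e, d, hd⟩ := symPow_expansion (p := p) (𝒱 := 𝒱) i
      have hab (x : N) : l (a x * b x) = ∑ t, d t (a x) * (l ∘ₗ LinearMap.mulLeft ℝ (e t)) (b x) :=
        calc l (a x * b x) = l ((∑ t, d t (a x) • e t) * b x) := by rw [← hd _ (ha.1 x)]
          _ = ∑ t, d t (a x) * (l ∘ₗ LinearMap.mulLeft ℝ (e t)) (b x) := by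
            simp [Finset.sum_mul]
      simp only [Pi.mul_apply, hab]
      exact contMDiff_finsetSum fun t _ => (ha.2 (d t)).mul (hb.2 _)

variable {I N}

theorem algebraMap_mem_smoothSymPow {f : N → ℝ} (hf : ContMDiff I 𝓘(ℝ, ℝ) ∞ f) :
    (fun x => algebraMap ℝ (GradedSym p 𝒱) (f x)) ∈ smoothSymPow p 𝒱 I N 0 := by
  refine ⟨fun x => ?_, fun l => ?_⟩
  · rw [symPow, pow_zero]
    exact Submodule.algebraMap_mem _
  · simp only [Algebra.algebraMap_eq_smul_one, map_smul, smul_eq_mul]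
    exact hf.mul contMDiff_const

end SmoothSymPow

variable {n : ℕ} {N : Type} [TopologicalSpace N] [ChartedSpace (EuclideanSpace ℝ (Fin n)) N]
  {U : Opens N}

theorem IsSmoothFormal.coeff_mem {f : U → FormalSym p 𝒱} (hf : IsSmoothFormal n N p 𝒱 f) (k : ℕ) :
    (fun x => PowerSeries.coeff k (f x).1) ∈
      smoothSymPow p 𝒱 𝓘(ℝ, EuclideanSpace ℝ (Fin n)) U k :=
  ⟨fun x => (f x).2 k, hf k⟩

theorem isSmoothFormal_algebraMap {f : U → ℝ}
    (hf : ContMDiff 𝓘(ℝ, EuclideanSpace ℝ (Fin n)) 𝓘(ℝ, ℝ) ∞ f) :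
    IsSmoothFormal n N p 𝒱 fun x : U => algebraMap ℝ _ (f x) := by
  intro k
  have hcoeff (x : U) : PowerSeries.coeff k (algebraMap ℝ (FormalSym p 𝒱) (f x)).1 =
      if k = 0 then algebraMap ℝ _ (f x) else 0 := by
    rw [← PowerSeries.coeff_C, ← PowerSeries.algebraMap_apply]
    rfl
  simp only [hcoeff]
  split_ifs
  · exact (algebraMap_mem_smoothSymPow hf).2
  · exact fun l => by simpa only [map_zero] using contMDiff_const

variable [FiniteDimensional ℝ V]

theorem contMDiff_body (f : formalSections n N p 𝒱 U) :
    ContMDiff 𝓘(ℝ, EuclideanSpace ℝ (Fin n)) 𝓘(ℝ, ℝ) ∞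
      fun x : U => FormalSym.body p 𝒱 (f.1 x) := by
  simp only [FormalSym.body_apply]
  exact f.2 0 (GradedSym.augmentation p 𝒱).toLinearMap

theorem isUnit_of_body_ne_zero (f : formalSections n N p 𝒱 U)
    (hf : ∀ x : U, FormalSym.body p 𝒱 (f.1 x) ≠ 0) : IsUnit f := by
  -- Inverting over the ring of functions `U → S(V)`, instead of at each point, shows at once that
  -- the coefficients of the inverse are smooth.
  let F : PowerSeries (U → GradedSym p 𝒱) := PowerSeries.mk fun k x => PowerSeries.coeff k (f.1 x).1
  let ev (x : U) : (U → GradedSym p 𝒱) →+* GradedSym p 𝒱 := Pi.evalRingHom _ x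
  have ev_F (x : U) : F.map (ev x) = (f.1 x).1 := by
    ext k
    rw [PowerSeries.coeff_map, PowerSeries.coeff_mk]
    rfl
  let u : (U → GradedSym p 𝒱)ˣ := MulEquiv.piUnits.symm fun x =>
    Units.map (algebraMap ℝ (GradedSym p 𝒱)).toMonoidHom (Units.mk0 _ (hf x))
  have hu : PowerSeries.constantCoeff F = u := by
    ext x
    rw [← PowerSeries.coeff_zero_eq_constantCoeff_apply, PowerSeries.coeff_mk,
      PowerSeries.coeff_zero_eq_constantCoeff_apply, ← FormalSym.algebraMap_body]
    rfl
  have hG : ∀ k, PowerSeries.coeff k (F.invOfUnit u) ∈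
      smoothSymPow p 𝒱 𝓘(ℝ, EuclideanSpace ℝ (Fin n)) U k := by
    refine coeff_invOfUnit_mem _ (fun k => ?_)
      (algebraMap_mem_smoothSymPow ((contMDiff_body f).inv₀ hf))
    rw [PowerSeries.coeff_mk]
    exact f.2.coeff_mem k
  let g : formalSections n N p 𝒱 U :=
    ⟨fun x => ⟨(F.invOfUnit u).map (ev x), fun k => (hG k).1 x⟩, fun k => (hG k).2⟩
  refine ⟨⟨f, g, ?_, ?_⟩, rfl⟩ <;> refine Subtype.ext (funext fun x => Subtype.ext ?_)
  · change (f.1 x).1 * (F.invOfUnit u).map (ev x) = 1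
    rw [← ev_F, ← map_mul, PowerSeries.mul_invOfUnit F u hu, map_one]
  · change (F.invOfUnit u).map (ev x) * (f.1 x).1 = 1
    rw [← ev_F, ← map_mul, PowerSeries.invOfUnit_mul F u hu, map_one]

variable [DecidableEq ℐ] [DirectSum.Decomposition 𝒱]

theorem exists_isLocalHom_stalk_formal (x : N) :
    ∃ e : (formalGradedSheaf n N p 𝒱).sheaf.presheaf.stalk x →+* ℝ, IsLocalHom e ∧
      ∀ (U : Opens N) (hx : x ∈ U) (f : formalSections n N p 𝒱 U),
        e ((formalGradedSheaf n N p 𝒱).sheaf.presheaf.germ U x hx f) =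
          FormalSym.body p 𝒱 (f.1 ⟨x, hx⟩) := by
  refine exists_isLocalHom_stalk (formalGradedSheaf n N p 𝒱).sheaf.presheaf x
    (fun (U : Opens N) hx => ((FormalSym.body p 𝒱).comp
      (Pi.evalRingHom (fun _ : U => FormalSym p 𝒱) ⟨x, hx⟩)).comp
        (formalSections n N p 𝒱 U).val.toRingHom)
    (fun _ _ _ => rfl) fun (U : Opens N) hx f hf => ?_
  obtain ⟨W, h, hxW, hW⟩ := exists_opens_ne_zero (contMDiff_body f).continuous hx hf
  exact ⟨W, homOfLE h, hxW, isUnit_of_body_ne_zero (formalRestrict n N p 𝒱 h f) hW⟩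

variable (p 𝒱 n N) in
theorem isRealValued_formal : IsRealValued (formalGradedSheaf n N p 𝒱).toPresheafedSpace where
  nonempty_ringHom := ⟨algebraMap ℝ (formalSections n N p 𝒱 ⊤)⟩
  exists_isLocalHom (x : N) := (exists_isLocalHom_stalk_formal x).imp fun _ h => h.1

theorem eval_formal (f : formalSections n N p 𝒱 U) {x : N} (hx : x ∈ U) :
    (isRealValued_formal p 𝒱 n N).eval f x =
      FormalSym.body p 𝒱 (f.1 ⟨x, hx⟩) := by
  obtain ⟨e, -, e_germ⟩ := exists_isLocalHom_stalk_formal (n := n) (p := p) (𝒱 := 𝒱) x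
  exact ((isRealValued_formal p 𝒱 n N).eval_eq e hx _).trans (e_germ U hx f)

theorem isSmoothlyValued_formal :
    IsSmoothlyValued 𝓘(ℝ, EuclideanSpace ℝ (Fin n)) (formalGradedSheaf n N p 𝒱) where
  isRealValued := isRealValued_formal p 𝒱 n N
  eval_of_mem_deg {U i} hi f hf := by
    funext x
    by_cases hx : x ∈ U
    · have hfx : PowerSeries.coeff 0 (f.1 ⟨x, hx⟩ : FormalSym p 𝒱).1 = 0 := by
        simpa only [symDeg_zero_of_ne hi, Submodule.mem_bot] using hf ⟨x, hx⟩ 0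
      refine (eval_formal f hx).trans ?_
      rw [FormalSym.body_apply, hfx, map_zero, Pi.zero_apply]
    · exact (isRealValued_formal p 𝒱 n N).eval_of_notMem f hx
  contMDiffOn_eval {U} f x hx := by
    refine (contMDiffAt_subtype_iff (x := (⟨x, hx⟩ : U)).mp ?_).contMDiffWithinAt
    exact (contMDiff_body f ⟨x, hx⟩).congr_of_eventuallyEq
      (.of_eq (funext fun y => eval_formal f y.2))
  exists_eval_eventuallyEq x f hf := by
    obtain ⟨T, hT, hT_open, hxT⟩ := mem_nhds_iff.mp hf
    let U : Opens N := ⟨T, hT_open⟩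
    have hfU : ContMDiff 𝓘(ℝ, EuclideanSpace ℝ (Fin n)) 𝓘(ℝ, ℝ) ∞ fun y : U => f y :=
      fun y => contMDiffAt_subtype_iff.mpr (hT y.2)
    let s : formalSections n N p 𝒱 U := ⟨_, isSmoothFormal_algebraMap hfU⟩
    refine ⟨U, s, hxT, ?_⟩
    filter_upwards [U.2.mem_nhds hxT] with y hy
    exact (eval_formal s hy).trans (FormalSym.body_algebraMap _)

end Formal

theorem IsGradedManifold.isSmoothlyValued {ℐ : Type*} [NonUnitalCommSemiring ℐ] [DecidableEq ℐ]
    {p : ℐ →+ ZMod 2} {V : Type} [AddCommGroup V] [Module ℝ V] [FiniteDimensional ℝ V]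
    {𝒱 : ℐ → Submodule ℝ V} [DirectSum.Decomposition 𝒱] {n : ℕ} {M : Type} [TopologicalSpace M]
    [ChartedSpace (EuclideanSpace ℝ (Fin n)) M] {𝒪 : GradedSheaf ℐ (TopCat.of M)}
    (h : IsGradedManifold n p 𝒱 M 𝒪) :
    IsSmoothlyValued 𝓘(ℝ, EuclideanSpace ℝ (Fin n)) 𝒪 := by
  refine .of_local_iso (J := 𝓘(ℝ, EuclideanSpace ℝ (Fin n))) fun x => ?_
  obtain ⟨U, hx, W, χ, hχ, hχ'⟩ := h x
  exact ⟨U, hx, W, _, _, formalGradedSheaf n W p 𝒱, χ, isSmoothlyValued_formal, hχ, hχ'⟩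

end

theorem mainTheorem4_general
    {ℐ : Type*} [NonUnitalCommSemiring ℐ] [DecidableEq ℐ]
    (p : ℐ →+ ZMod 2)
    {V : Type} [AddCommGroup V] [Module ℝ V] [FiniteDimensional ℝ V]
    (𝒱 : ℐ → Submodule ℝ V) [DirectSum.Decomposition 𝒱] (n : ℕ) :
    (∀ U : Opens (EuclideanSpace ℝ (Fin n)),
      ∃ φ : smoothSpace ℐ n U ⟶ gradedDomain n p 𝒱 U,
        GradedRingedSpace.base φ = 𝟙 (TopCat.of U) ∧ Mono φ ∧
        GradedRingedSpace.IsLocal φ ∧ GradedRingedSpace.IsRealLinear φ ∧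
        GradedRingedSpace.IsStalkSurjective φ ∧
        ∀ ψ : smoothSpace ℐ n U ⟶ gradedDomain n p 𝒱 U,
          GradedRingedSpace.base ψ = 𝟙 (TopCat.of U) → ψ = φ) ∧
    (∀ (M : Type) [TopologicalSpace M] [ChartedSpace (EuclideanSpace ℝ (Fin n)) M]
      [IsManifold 𝓘(ℝ, EuclideanSpace ℝ (Fin n)) ∞ M] (𝒪 : GradedSheaf ℐ (TopCat.of M)),
      IsGradedManifold n p 𝒱 M 𝒪 →
      ∃ φ : smoothSpace ℐ n M ⟶ (⟨TopCat.of M, 𝒪⟩ : GradedRingedSpace ℐ),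
        GradedRingedSpace.base φ = 𝟙 (TopCat.of M) ∧ Mono φ ∧
        GradedRingedSpace.IsLocal φ ∧ GradedRingedSpace.IsRealLinear φ ∧
        GradedRingedSpace.IsStalkSurjective φ ∧
        ∀ ψ : smoothSpace ℐ n M ⟶ (⟨TopCat.of M, 𝒪⟩ : GradedRingedSpace ℐ),
          GradedRingedSpace.base ψ = 𝟙 (TopCat.of M) → ψ = φ) ∧
    (∀ {E H : Type*} [NormedAddCommGroup E] [NormedSpace ℝ E] [TopologicalSpace H]
      (I : ModelWithCorners ℝ E H) (M : Type) [TopologicalSpace M] [ChartedSpace H M]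
      [IsManifold I ∞ M]
      (F : smoothSheafRing I 𝓘(ℝ, ℝ) M ℝ ⟶ smoothSheafRing I 𝓘(ℝ, ℝ) M ℝ), F = 𝟙 _) :=
  ⟨fun _ => isSmoothlyValued_formal.exists_unique_hom,
    fun _ _ _ _ _ h𝒪 => h𝒪.isSmoothlyValued.exists_unique_hom,
    fun _ _ _ _ _ F => smoothSheafRing_hom_eq_id F⟩

theorem mainTheorem4
    {ℐ : Type*} [NonUnitalCommSemiring ℐ] [IsCancelAdd ℐ] [Countable ℐ] [DecidableEq ℐ]
    (p : ℐ →+ ZMod 2) (hp : p ≠ 0)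
    {V : Type} [AddCommGroup V] [Module ℝ V] [FiniteDimensional ℝ V]
    (𝒱 : ℐ → Submodule ℝ V) [DirectSum.Decomposition 𝒱] (h𝒱 : 𝒱 0 = ⊥) (n : ℕ) :
    -- graded domains
    (∀ U : Opens (EuclideanSpace ℝ (Fin n)),
      ∃ φ : smoothSpace ℐ n U ⟶ gradedDomain n p 𝒱 U,
        GradedRingedSpace.base φ = 𝟙 (TopCat.of U) ∧ Mono φ ∧
        GradedRingedSpace.IsLocal φ ∧ GradedRingedSpace.IsRealLinear φ ∧
        GradedRingedSpace.IsStalkSurjective φ ∧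
        ∀ ψ : smoothSpace ℐ n U ⟶ gradedDomain n p 𝒱 U,
          GradedRingedSpace.base ψ = 𝟙 (TopCat.of U) → ψ = φ) ∧
    -- graded manifolds
    (∀ (M : Type) [TopologicalSpace M] [ChartedSpace (EuclideanSpace ℝ (Fin n)) M]
      [IsManifold 𝓘(ℝ, EuclideanSpace ℝ (Fin n)) ∞ M] (𝒪 : GradedSheaf ℐ (TopCat.of M)),
      IsGradedManifold n p 𝒱 M 𝒪 →
      ∃ φ : smoothSpace ℐ n M ⟶ (⟨TopCat.of M, 𝒪⟩ : GradedRingedSpace ℐ),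
        GradedRingedSpace.base φ = 𝟙 (TopCat.of M) ∧ Mono φ ∧
        GradedRingedSpace.IsLocal φ ∧ GradedRingedSpace.IsRealLinear φ ∧
        GradedRingedSpace.IsStalkSurjective φ ∧
        ∀ ψ : smoothSpace ℐ n M ⟶ (⟨TopCat.of M, 𝒪⟩ : GradedRingedSpace ℐ),
          GradedRingedSpace.base ψ = 𝟙 (TopCat.of M) → ψ = φ) ∧
    -- endomorphisms of the sheaf of rings of smooth functions
    (∀ (M : Type) [TopologicalSpace M] [ChartedSpace (EuclideanSpace ℝ (Fin n)) M]
      [IsManifold 𝓘(ℝ, EuclideanSpace ℝ (Fin n)) ∞ M]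
      (F : smoothSheafRing 𝓘(ℝ, EuclideanSpace ℝ (Fin n)) 𝓘(ℝ, ℝ) M ℝ ⟶
        smoothSheafRing 𝓘(ℝ, EuclideanSpace ℝ (Fin n)) 𝓘(ℝ, ℝ) M ℝ), F = 𝟙 _) :=
  let ⟨domains, manifolds, endomorphisms⟩ := mainTheorem4_general p 𝒱 n
  ⟨domains, manifolds, fun M => endomorphisms 𝓘(ℝ, EuclideanSpace ℝ (Fin n)) M⟩
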